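/- Let $p$ be a number of predictors and let $(Y_1,Y_2,X_1,\dots,X_p)$ be a random vector with a joint Lebesgue density $f_{Y_1,Y_2,\mathbf X}$, with marginal distribution functions $F_{Y_j},F_{X_i}$ and marginal densities $f_{Y_j},f_{X_i}$, and probability integral transforms $V_j=F_{Y_j}(Y_j)$, $U_i=F_{X_i}(X_i)$. Write $\mathbf X_{1:k}=(X_1,\dots,X_k)$, $\mathbf U_{a:b}=(U_a,\dots,U_b)$ (empty if $b<a$), and let $F_{Z|\mathbf X_{1:k}}$ denote the conditional distribution function of $Z$ given $\mathbf X_{1:k}$. The edges of the Y-vine tree sequence $T_1,\dots,T_{p+1}$ are, with conditioned variables before and conditioning variables after the semicolon: in $T_k$, $1\le k\le p$, the edges $V_jU_k;\mathbf U_{1:k-1}$ ($j=1,2$) and $U_iU_{i+k};\mathbf U_{i+1:i+k-1}$ ($1\le i\le p-k$); in $T_{p+1}$, the edge $V_1V_2;\mathbf U$ with $\mathbf U=\mathbf U_{1:p}$. Assume that the copula of $(Y_1,Y_2,\mathbf X)$, i.e. the law of $(V_1,V_2,\mathbf U)$, is a Y-vine copula under the simplifying assumption: for every edge $AB;\mathbf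 D$ there is a bivariate copula $C_{A,B;\mathbf D}$ with density $c_{A,B;\mathbf D}$, not depending on the value of $\mathbf D$, which is the copula of the conditional law of $(A,B)$ given $\mathbf D=\mathbf d$, for almost every $\mathbf d$. Then the conditional density $f_{Y_1,Y_2|\mathbf X}=f_{Y_1,Y_2,\mathbf X}/f_{\mathbf X}$ satisfies, for almost every $\mathbf x$ with respect to the law of $\mathbf X$ and Lebesgue-almost every $(y_1,y_2)$, $$f_{Y_1,Y_2|\mathbf X}(y_1,y_2|\mathbf x)=\prod_{i=1}^{p}\prod_{j=1,2}c_{V_j,U_i;\mathbf U_{1:i-1}}\bigl(F_{Y_j|\mathbf X_{1:i-1}}(y_j|\mathbf x_{1:i-1}),F_{X_i|\mathbf X_{1:i-1}}(x_i|\mathbf x_{1:i-1})\bigr)\cdot c_{V_1,V_2;\mathbf U}\bigl(F_{Y_1|\mathbf X}(y_1|\mathbf x),F_{Y_2|\mathbf X}(y_2|\mathbf x)\bigr)\cdot\prod_{j=1,2}f_{Y_j}(y_j).$$ -/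

import Mathlib

open MeasureTheory ProbabilityTheory Set

noncomputable section

namespace YVine

/-! ### Bivariate copulas with a density -/

/-- An absolutely continuous bivariate copula, given by its density on the unit square. -/
structure PairCopula where
  /-- the copula density `c(u, v)` -/
  density : ℝ → ℝ → ℝ
  measurable_density : Measurable (fun w : ℝ × ℝ => density w.1 w.2)
  density_nonneg : ∀ u v, 0 ≤ density u v
  integrableOn_density :
    IntegrableOn (fun w : ℝ × ℝ => density w.1 w.2) (Icc 0 1 ×ˢ Icc 0 1) volume
  uniform_left : ∀ u ∈ Icc (0 : ℝ) 1,
    ∫ w in Icc (0 : ℝ) u ×ˢ Icc (0 : ℝ) 1, density w.1 w.2 = u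
  uniform_right : ∀ v ∈ Icc (0 : ℝ) 1,
    ∫ w in Icc (0 : ℝ) 1 ×ˢ Icc (0 : ℝ) v, density w.1 w.2 = v

/-- The distribution function `C(u, v) = ∫₀ᵘ ∫₀ᵛ c` of a pair copula, for `u, v ∈ [0, 1]`. -/
def PairCopula.cdf (C : PairCopula) (u v : ℝ) : ℝ :=
  ∫ w in Icc (0 : ℝ) u ×ˢ Icc (0 : ℝ) v, C.density w.1 w.2

/-! ### Marginal and conditional distributions of a law on `ι → ℝ` -/

section Laws

variable {ι : Type} [Fintype ι]

/-- The law of the coordinate `l` of a random vector with law `μ`. -/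
def marginal (μ : Measure (ι → ℝ)) (l : ι) : Measure ℝ :=
  μ.map (fun z => z l)

/-- The copula associated with a law `μ` with continuous margins: the law of the vector of
probability integral transforms `F_l(Z_l)`, where `Z` has law `μ`. -/
def copula (μ : Measure (ι → ℝ)) : Measure (ι → ℝ) :=
  μ.map (fun z l => ProbabilityTheory.cdf (marginal μ l) (z l))

instance isProbabilityMeasure_copula (μ : Measure (ι → ℝ)) [IsProbabilityMeasure μ] :
    IsProbabilityMeasure (copula μ) := by
  refine Measure.isProbabilityMeasure_map (Measurable.aemeasurable ?_)
  exact measurable_pi_lambda _ fun l =>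
    (ProbabilityTheory.cdf (marginal μ l)).mono.measurable.comp (measurable_pi_apply l)

/-- `condCDF μ l D z a = F_{Z_l | Z_D}(a | z_D)`: the conditional distribution function of the
coordinate `l` given the coordinates in `D`. It depends on `z` only through `(z_i)_{i ∈ D}`. -/
def condCDF (μ : Measure (ι → ℝ)) [IsFiniteMeasure μ] (l : ι) (D : Finset ι)
    (z : ι → ℝ) (a : ℝ) : ℝ :=
  (condDistrib (fun w : ι → ℝ => w l) (fun w => D.restrict w) μ (D.restrict z)).real (Iic a)

/-- `condCDF₂ μ l m D z a b = F_{Z_l, Z_m | Z_D}(a, b | z_D)`: the joint conditional distribution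
function of the coordinates `l` and `m` given the coordinates in `D`. -/
def condCDF₂ (μ : Measure (ι → ℝ)) [IsFiniteMeasure μ] (l m : ι) (D : Finset ι)
    (z : ι → ℝ) (a b : ℝ) : ℝ :=
  (condDistrib (fun w : ι → ℝ => (w l, w m)) (fun w => D.restrict w) μ (D.restrict z)).real
    (Iic a ×ˢ Iic b)

/-- The (Lebesgue) density of a law on `ι → ℝ`. -/
def density (μ : Measure (ι → ℝ)) (z : ι → ℝ) : ℝ :=
  (μ.rnDeriv volume z).toReal

/-- The (Lebesgue) density of the coordinate `l`. -/
def marginalDensity (μ : Measure (ι → ℝ)) (l : ι) (t : ℝ) : ℝ :=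
  ((marginal μ l).rnDeriv volume t).toReal

end Laws

/-! ### The Y-vine tree sequence -/

/-- The variables: two responses `Sum.inl 0`, `Sum.inl 1` and `p` predictors `Sum.inr i`. -/
abbrev Var (p : ℕ) : Type := Fin 2 ⊕ Fin p

/-- The set of predictors with index in `s`. -/
def predictors {p : ℕ} (s : Finset (Fin p)) : Finset (Var p) :=
  s.map Function.Embedding.inr

/-- The edges of all `p + 1` trees of the Y-vine tree sequence. Predictor indices start at `0`.
* `response j i`: the edge `V_j U_i ; U_{0 : i-1}` of the tree number `i + 1`,
* `predictor i k`, `i < k`: the edge `U_i U_k ; U_{i+1 : k-1}` of the tree number `k - i`,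
* `top`: the edge `V_1 V_2 ; U` of the last tree, number `p + 1`. -/
inductive Edge (p : ℕ) : Type
  | response (j : Fin 2) (i : Fin p) : Edge p
  | predictor (i k : Fin p) (h : i < k) : Edge p
  | top : Edge p

namespace Edge

variable {p : ℕ}

/-- The first of the two nodes that the edge joins, as the set of all variables occurring in the
label of the node. -/
def node₁ : Edge p → Finset (Var p)
  | response j i => insert (Sum.inl j) (predictors (Finset.Iio i))
  | predictor i k _ => predictors (Finset.Ico i k)
  | top => insert (Sum.inl 0) (predictors Finset.univ)

/-- The second of the two nodes that the edge joins. -/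
def node₂ : Edge p → Finset (Var p)
  | response _ i => predictors (Finset.Iic i)
  | predictor i k _ => predictors (Finset.Ioc i k)
  | top => insert (Sum.inl 1) (predictors Finset.univ)

/-- The conditioning set of an edge: the variables common to its two nodes. -/
def conditioning (e : Edge p) : Finset (Var p) := e.node₁ ∩ e.node₂

/-- The first conditioned variable: the one that belongs to the first node only. -/
def left : Edge p → Var p
  | response j _ => Sum.inl j
  | predictor i _ _ => Sum.inr i
  | top => Sum.inl 0

/-- The second conditioned variable: the one that belongs to the second node only. -/
def right : Edge p → Var p
  | response _ i => Sum.inr i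
  | predictor _ k _ => Sum.inr k
  | top => Sum.inl 1

theorem node₁_sdiff_node₂ (e : Edge p) : e.node₁ \ e.node₂ = {e.left} := by
  ext v
  cases e <;> rcases v with v | v <;> simp [node₁, node₂, left, predictors] <;> grind

theorem node₂_sdiff_node₁ (e : Edge p) : e.node₂ \ e.node₁ = {e.right} := by
  ext v
  cases e <;> rcases v with v | v <;> simp [node₁, node₂, right, predictors] <;> grind

end Edge

/-- `ν` is a Y-vine copula with pair copulas `C`: it has uniform margins, and for every edge `e` of
the Y-vine tree sequence, `C e` is the copula of the conditional law of the two conditioned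
variables given the variables in the conditioning set. That `C e` does not depend on the values of
the conditioning variables is the simplifying assumption. -/
structure IsYVineCopula {p : ℕ} (ν : Measure (Var p → ℝ)) [IsProbabilityMeasure ν]
    (C : Edge p → PairCopula) : Prop where
  uniform : ∀ l, marginal ν l = volume.restrict (Icc 0 1)
  pair : ∀ e : Edge p, ∀ᵐ w ∂ν, ∀ a b : ℝ,
    condCDF₂ ν e.left e.right e.conditioning w a b =
      (C e).cdf (condCDF ν e.left e.conditioning w a) (condCDF ν e.right e.conditioning w b)

/-- The law of the predictors `X = (X_1, …, X_p)`. -/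
def predictorLaw {p : ℕ} (μ : Measure (Var p → ℝ)) : Measure (Fin p → ℝ) :=
  μ.map (fun z i => z (Sum.inr i))

/-- The conditional density `f_{Y|X}(y | x) = f_{Y,X}(y, x) / f_X(x)` of the responses given the
predictors. -/
def condDensity {p : ℕ} (μ : Measure (Var p → ℝ)) (y : Fin 2 → ℝ) (x : Fin p → ℝ) : ℝ :=
  density μ (Sum.elim y x) / density (predictorLaw μ) x

end YVine

end

open Filter Topology

namespace YVine

/-! The argument works with conditional laws as measures and divides by `f_X` only at the end. By
Sklar's theorem for densities (`PairCopula.eq_withDensity`), an edge `AB;D` says that the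
conditional law of the pair given `D` has density `c(F_{A|D}, F_{B|D})` with respect to the product
of the conditional margins. Hence adding `B` to the conditioning variables multiplies the
conditional law of `A` by this factor (`condDistrib_insert_eq_withDensity`).

Starting from the marginal law of `Y_j` and adding the predictors one at a time along the response
edges gives the law of `Y_j` given `X` (`condDistrib_response_eq_withDensity`). The top edge couples
the two responses, and multiplying by `f_X` gives the joint density (`eq_withDensity_yvineDensity`).

The hypothesis concerns the copula, not the law itself. The transforms `F_l` are injective off a
null set, so conditioning on the `U`'s amounts to conditioning on the `X`'s, and the edge identities
pass to the original scale (`condCDF₂_eq_of_copula`). -/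

/-! ### The probability integral transform of an atomless law -/

theorem continuous_cdf (α : Measure ℝ) [IsProbabilityMeasure α] [NullSingletonClass α] : Continuous (ProbabilityTheory.cdf α) := by
  refine continuous_iff_continuousAt.2 fun a => ?_
  refine (monotone_cdf α).continuousAt_iff_leftLim_eq_rightLim.2 ?_
  have h := (ProbabilityTheory.cdf α).measure_singleton a
  rw [measure_cdf, measure_singleton, eq_comm, ENNReal.ofReal_eq_zero] at h
  rw [(ProbabilityTheory.cdf α).rightLim_eq]
  exact le_antisymm ((monotone_cdf α).leftLim_le le_rfl) (by linarith)

/-- For `0 ≤ u < 1` a nonempty sublevel set of the continuous `F` is a ray `Iic a` with `F a = u`,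
so its mass is `u`. -/
theorem map_cdf_eq_volume_restrict (α : Measure ℝ) [IsProbabilityMeasure α]
    [NullSingletonClass α] :
    α.map (ProbabilityTheory.cdf α) = volume.restrict (Icc 0 1) := by
  have hF := continuous_cdf α
  have : IsProbabilityMeasure (α.map (ProbabilityTheory.cdf α)) :=
    Measure.isProbabilityMeasure_map hF.measurable.aemeasurable
  refine Measure.ext_of_Iic _ _ fun u => ?_
  rw [Measure.map_apply hF.measurable measurableSet_Iic, Measure.restrict_apply measurableSet_Iic]
  rcases lt_or_ge u 0 with hu | hu
  · have h1 : ProbabilityTheory.cdf α ⁻¹' Iic u = ∅ := by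
      ext t
      simpa using hu.trans_le (cdf_nonneg α t)
    have h2 : Iic u ∩ Icc (0 : ℝ) 1 = ∅ := by
      ext t
      simp only [mem_inter_iff, mem_Iic, mem_Icc, mem_empty_iff_false, iff_false]
      intro h
      linarith [h.1, h.2.1]
    rw [h1, h2, measure_empty, measure_empty]
  rcases le_or_gt 1 u with hu1 | hu1
  · have h1 : ProbabilityTheory.cdf α ⁻¹' Iic u = univ := by
      ext t
      simpa using (cdf_le_one α t).trans hu1
    have h2 : Iic u ∩ Icc (0 : ℝ) 1 = Icc 0 1 :=
      inter_eq_right.2 fun t ht => ht.2.trans hu1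
    rw [h1, h2]
    simp
  have h2 : Iic u ∩ Icc (0 : ℝ) 1 = Icc 0 u := by
    ext t
    simp only [mem_inter_iff, mem_Iic, mem_Icc]
    constructor
    · exact fun h => ⟨h.2.1, h.1⟩
    · exact fun h => ⟨h.2, h.1, h.2.trans hu1.le⟩
  rw [h2, Real.volume_Icc, sub_zero]
  have hIVT : 0 < u → ∃ b, ProbabilityTheory.cdf α b = u := fun h0 => by
    obtain ⟨x, hx⟩ := ((tendsto_cdf_atBot α).eventually (gt_mem_nhds h0)).exists
    obtain ⟨y, hy⟩ := ((tendsto_cdf_atTop α).eventually (lt_mem_nhds hu1)).exists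
    exact mem_range_of_exists_le_of_exists_ge hF ⟨x, hx.le⟩ ⟨y, hy.le⟩
  -- The sublevel set can be empty only for `u = 0`: a positive `u` is a value of `F`.
  rcases (ProbabilityTheory.cdf α ⁻¹' Iic u).eq_empty_or_nonempty with he | hne
  · rw [he, measure_empty]
    rcases hu.eq_or_lt with rfl | h0
    · simp
    · obtain ⟨b, hb⟩ := hIVT h0
      have : b ∈ ProbabilityTheory.cdf α ⁻¹' Iic u := hb.le
      simp [he] at this
  · obtain ⟨y, hy⟩ := ((tendsto_cdf_atTop α).eventually (lt_mem_nhds hu1)).exists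
    have hbdd : BddAbove (ProbabilityTheory.cdf α ⁻¹' Iic u) := by
      refine ⟨y, fun t ht => ?_⟩
      by_contra! h
      exact absurd (hy.trans_le (monotone_cdf α h.le)) (not_lt.2 ht)
    obtain ⟨a, ha⟩ : ∃ a, IsGreatest (ProbabilityTheory.cdf α ⁻¹' Iic u) a :=
      ⟨_, (isClosed_Iic.preimage hF).csSup_mem hne hbdd, fun _ => le_csSup hbdd⟩
    have hset : ProbabilityTheory.cdf α ⁻¹' Iic u = Iic a := by
      ext t
      exact ⟨fun h => ha.2 h, fun h => (monotone_cdf α h).trans ha.1⟩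
    have hau : ProbabilityTheory.cdf α a = u := by
      refine le_antisymm ha.1 ?_
      rcases hu.eq_or_lt with rfl | h0
      · exact cdf_nonneg α a
      · obtain ⟨b, hb⟩ := hIVT h0
        exact hb ▸ monotone_cdf α (ha.2 hb.le)
    rw [hset, ← ofReal_cdf, hau]

/-- The points to the left of which the distribution function of `α` is constant. -/
def flatSet (α : Measure ℝ) : Set ℝ :=
  ⋃ q : ℚ, {t | (q : ℝ) < t ∧ ProbabilityTheory.cdf α t = ProbabilityTheory.cdf α q}

theorem measurableSet_flatSet (α : Measure ℝ) : MeasurableSet (flatSet α) :=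
  MeasurableSet.iUnion fun _ => measurableSet_Ioi.inter
    ((monotone_cdf α).measurable (measurableSet_singleton _))

theorem mem_flatSet (α : Measure ℝ) {s t : ℝ} (hst : s < t)
    (h : ProbabilityTheory.cdf α t ≤ ProbabilityTheory.cdf α s) : t ∈ flatSet α := by
  obtain ⟨q, hq, hqt⟩ := exists_rat_btwn hst
  refine mem_iUnion.2 ⟨q, hqt, le_antisymm (h.trans (monotone_cdf α hq.le))
    (monotone_cdf α hqt.le)⟩

theorem injOn_cdf_compl_flatSet (α : Measure ℝ) : InjOn (ProbabilityTheory.cdf α) (flatSet α)ᶜ := by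
  intro s hs t ht hst
  rcases lt_trichotomy s t with h | h | h
  · exact absurd (mem_flatSet α h hst.ge) ht
  · exact h
  · exact absurd (mem_flatSet α h hst.le) hs

/-- Each of the countably many pieces is mapped by `F` to a single value, and `F` has a uniform law.
-/
theorem measure_flatSet (α : Measure ℝ) [IsProbabilityMeasure α]
    [NullSingletonClass α] : α (flatSet α) = 0 := by
  refine measure_iUnion_null fun q => ?_
  refine measure_mono_null (t := ProbabilityTheory.cdf α ⁻¹' {ProbabilityTheory.cdf α q})
    (fun t ht => ht.2) ?_
  rw [← Measure.map_apply (monotone_cdf α).measurable (measurableSet_singleton _),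
    map_cdf_eq_volume_restrict]
  exact measure_singleton _

theorem setOf_cdf_le_subset (α : Measure ℝ) (s : ℝ) :
    {t | ProbabilityTheory.cdf α t ≤ ProbabilityTheory.cdf α s} ⊆ Iic s ∪ flatSet α := by
  intro t ht
  rcases le_or_gt t s with h | h
  · exact Or.inl h
  · exact Or.inr (mem_flatSet α h ht)

/-- `F` is injective on the complement of the null set `flatSet α`. A measurable injection of
standard Borel spaces is a measurable embedding, so its inverse extends measurably to the line. -/
theorem exists_leftInverse_cdf (α : Measure ℝ) [IsProbabilityMeasure α]
    [NullSingletonClass α] :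
    ∃ g : ℝ → ℝ, Measurable g ∧ ∀ᵐ t ∂α, g (ProbabilityTheory.cdf α t) = t := by
  have hm := (measurableSet_flatSet α).compl
  have : StandardBorelSpace ((flatSet α)ᶜ : Set ℝ) := hm.standardBorel
  have he : MeasurableEmbedding (fun t : ((flatSet α)ᶜ : Set ℝ) => ProbabilityTheory.cdf α t) :=
    ((monotone_cdf α).measurable.comp measurable_subtype_coe).measurableEmbedding
      (injOn_iff_injective.1 (injOn_cdf_compl_flatSet α))
  obtain ⟨g, hg, hgF⟩ := he.exists_measurable_extend measurable_subtype_coe fun _ => ⟨0⟩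
  refine ⟨g, hg, ?_⟩
  have h0 : ∀ᵐ t ∂α, t ∉ flatSet α := measure_eq_zero_iff_ae_notMem.1 (measure_flatSet α)
  filter_upwards [h0] with t ht
  exact congrFun hgF ⟨t, ht⟩

/-! ### Sklar's theorem for pair copulas with a density -/

theorem ext_of_Iic_prod {ρ σ : Measure (ℝ × ℝ)} [IsFiniteMeasure ρ]
    (h : ∀ a b, ρ (Iic a ×ˢ Iic b) = σ (Iic a ×ˢ Iic b)) : ρ = σ := by
  have hspan : IsCountablySpanning (range (Iic : ℝ → Set ℝ)) :=
    ⟨fun n : ℕ => Iic n, fun n => ⟨n, rfl⟩, iUnion_eq_univ_iff.2 exists_nat_ge⟩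
  refine Measure.ext_of_generateFrom_of_iUnion
    (image2 (· ×ˢ ·) (range (Iic : ℝ → Set ℝ)) (range (Iic : ℝ → Set ℝ)))
    (fun n : ℕ => Iic (n : ℝ) ×ˢ Iic (n : ℝ)) ?_
    (isPiSystem_Iic.prod isPiSystem_Iic) ?_ ?_ (fun n => measure_ne_top _ _) ?_
  · exact (generateFrom_eq_prod (borel_eq_generateFrom_Iic ℝ ▸ BorelSpace.measurable_eq.symm)
      (borel_eq_generateFrom_Iic ℝ ▸ BorelSpace.measurable_eq.symm) hspan hspan).symm
  · refine iUnion_eq_univ_iff.2 fun w => ?_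
    obtain ⟨n, hn⟩ := exists_nat_ge (max w.1 w.2)
    exact ⟨n, (le_max_left _ _).trans hn, (le_max_right _ _).trans hn⟩
  · exact fun n => ⟨_, ⟨n, rfl⟩, _, ⟨n, rfl⟩, rfl⟩
  · rintro _ ⟨_, ⟨a, rfl⟩, _, ⟨b, rfl⟩, rfl⟩
    exact h a b

theorem PairCopula.ofReal_cdf (C : PairCopula) {u v : ℝ} (hu : u ≤ 1) (hv : v ≤ 1) :
    ENNReal.ofReal (C.cdf u v) =
      ∫⁻ w in Icc 0 u ×ˢ Icc 0 v, ENNReal.ofReal (C.density w.1 w.2) := by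
  refine ofReal_integral_eq_lintegral_ofReal ?_ (ae_of_all _ fun w => C.density_nonneg _ _)
  exact C.integrableOn_density.mono_set
    (prod_mono (Icc_subset_Icc le_rfl hu) (Icc_subset_Icc le_rfl hv))

theorem PairCopula.measurable_ofReal_density (C : PairCopula) :
    Measurable fun w : ℝ × ℝ => ENNReal.ofReal (C.density w.1 w.2) :=
  C.measurable_density.ennreal_ofReal

/-- Sklar's theorem for densities. -/
theorem PairCopula.eq_withDensity (C : PairCopula) {ρ : Measure (ℝ × ℝ)} {α β : Measure ℝ}
    [IsFiniteMeasure ρ] [IsProbabilityMeasure α] [IsProbabilityMeasure β] [NullSingletonClass α] [NullSingletonClass β]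
    (h : ∀ a b, ρ.real (Iic a ×ˢ Iic b) =
      C.cdf (ProbabilityTheory.cdf α a) (ProbabilityTheory.cdf β b)) :
    ρ = (α.prod β).withDensity fun w =>
      ENNReal.ofReal (C.density (ProbabilityTheory.cdf α w.1) (ProbabilityTheory.cdf β w.2)) := by
  have hα := (monotone_cdf α).measurable
  have hβ := (monotone_cdf β).measurable
  refine ext_of_Iic_prod fun a b => ?_
  -- A ray and the corresponding sublevel set of `F` differ only inside `flatSet γ`.
  have key : ∀ (γ : Measure ℝ) [IsProbabilityMeasure γ] [NullSingletonClass γ] (s : ℝ),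
      (Iic s : Set ℝ) =ᵐ[γ]
        ProbabilityTheory.cdf γ ⁻¹' (Iic (ProbabilityTheory.cdf γ s)) := by
    intro γ _ _ s
    have h0 : ∀ᵐ t ∂γ, t ∉ flatSet γ := measure_eq_zero_iff_ae_notMem.1 (measure_flatSet γ)
    filter_upwards [h0] with t ht
    refine propext ⟨fun hts => monotone_cdf γ hts, fun hts => ?_⟩
    exact (setOf_cdf_le_subset γ s hts).resolve_right ht
  rw [← ENNReal.ofReal_toReal (measure_ne_top ρ _), ← measureReal_def, h,
    C.ofReal_cdf (cdf_le_one _ _) (cdf_le_one _ _),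
    withDensity_apply _ (measurableSet_Iic.prod measurableSet_Iic),
    ← Measure.prod_restrict, Measure.restrict_congr_set (key α a),
    Measure.restrict_congr_set (key β b), Measure.prod_restrict]
  change _ = ∫⁻ w in Prod.map (ProbabilityTheory.cdf α) (ProbabilityTheory.cdf β) ⁻¹'
      (Iic (ProbabilityTheory.cdf α a) ×ˢ Iic (ProbabilityTheory.cdf β b)),
      (fun w : ℝ × ℝ => ENNReal.ofReal (C.density w.1 w.2))
        (Prod.map (ProbabilityTheory.cdf α) (ProbabilityTheory.cdf β) w) ∂(α.prod β)
  -- Change of variables: `F_α × F_β` maps `α ⊗ β` to the uniform law on the unit square.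
  rw [← setLIntegral_map (measurableSet_Iic.prod measurableSet_Iic) C.measurable_ofReal_density
    (hα.prodMap hβ), ← Measure.map_prod_map _ _ hα hβ, map_cdf_eq_volume_restrict,
    map_cdf_eq_volume_restrict, Measure.prod_restrict,
    Measure.restrict_restrict (measurableSet_Iic.prod measurableSet_Iic), prod_inter_prod]
  have hI : ∀ u : ℝ, u ≤ 1 → Iic u ∩ Icc 0 1 = Icc 0 u := fun u hu => by
    ext t
    simp only [mem_inter_iff, mem_Iic, mem_Icc]
    exact ⟨fun h => ⟨h.2.1, h.1⟩, fun h => ⟨h.2, h.1, h.2.trans hu⟩⟩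
  rw [hI _ (cdf_le_one _ _), hI _ (cdf_le_one _ _)]
  rfl

/-! ### General facts on regular conditional distributions -/

section CondDistrib

variable {Ω 𝓧 𝓧' E E' : Type*} [MeasurableSpace Ω] [MeasurableSpace 𝓧] [MeasurableSpace 𝓧']
  [MeasurableSpace E] [StandardBorelSpace E] [Nonempty E]
  [MeasurableSpace E'] [StandardBorelSpace E'] [Nonempty E']
  {μ : Measure Ω} [IsFiniteMeasure μ] {X : Ω → 𝓧} {Y : Ω → E}

theorem lintegral_condDistrib (hX : Measurable X) (hY : Measurable Y)
    {φ : 𝓧 × E → ENNReal} (hφ : Measurable φ) :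
    ∫⁻ ω, φ (X ω, Y ω) ∂μ = ∫⁻ ω, ∫⁻ y, φ (X ω, y) ∂(condDistrib Y X μ (X ω)) ∂μ := by
  rw [← lintegral_map hφ (hX.prodMk hY), ← compProd_map_condDistrib hY.aemeasurable,
    Measure.lintegral_compProd hφ]
  exact lintegral_map hφ.lintegral_kernel_prod_right' hX

/-- Conditioning on `g ∘ X` is the same as conditioning on `X` if `g` is almost surely
injective. -/
theorem condDistrib_comp_right_ae_eq (hX : Measurable X) (hY : Measurable Y) {g : 𝓧 → 𝓧'}
    (hg : Measurable g) {h : 𝓧' → 𝓧} (hh : Measurable h) (hhg : ∀ᵐ ω ∂μ, h (g (X ω)) = X ω) :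
    ∀ᵐ ω ∂μ, condDistrib Y (g ∘ X) μ (g (X ω)) = condDistrib Y X μ (X ω) := by
  -- The kernel given `X`, read through the left inverse `h`, disintegrates the law of `(g ∘ X, Y)`;
  -- disintegrations are a.e. unique.
  have key : condDistrib Y (g ∘ X) μ =ᵐ[μ.map (g ∘ X)] (condDistrib Y X μ).comap h hh := by
    refine condDistrib_ae_eq_of_measure_eq_compProd _ hY.aemeasurable ?_
    refine Measure.ext_of_lintegral _ fun φ hφ => ?_
    rw [Measure.lintegral_compProd hφ, lintegral_map hφ ((hg.comp hX).prodMk hY),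
      lintegral_map hφ.lintegral_kernel_prod_right' (hg.comp hX)]
    change ∫⁻ ω, (fun q : 𝓧 × E => φ (g q.1, q.2)) (X ω, Y ω) ∂μ = _
    have hψ : Measurable fun q : 𝓧 × E => φ (g q.1, q.2) :=
      hφ.comp ((hg.comp measurable_fst).prodMk measurable_snd)
    refine (lintegral_condDistrib hX hY hψ).trans (lintegral_congr_ae ?_)
    filter_upwards [hhg] with ω hω
    simp [Kernel.comap_apply, hω]
  filter_upwards [ae_of_ae_map (hg.comp hX).aemeasurable key, hhg] with ω h1 h2
  rw [Function.comp_apply] at h1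
  rw [h1, Kernel.comap_apply, h2]

theorem condDistrib_null_of_map_null (hX : Measurable X) (hY : Measurable Y) {N : Set E}
    (hN : MeasurableSet N) (h : μ (Y ⁻¹' N) = 0) :
    ∀ᵐ ω ∂μ, condDistrib Y X μ (X ω) N = 0 := by
  have h1 := setLIntegral_preimage_condDistrib (μ := μ) hX hY.aemeasurable hN MeasurableSet.univ
  rw [preimage_univ, Measure.restrict_univ, univ_inter, h] at h1
  exact (lintegral_eq_zero_iff ((Kernel.measurable_coe _ hN).comp hX)).1 h1

/-- Uniqueness of the disintegration without assuming `η` finite, as needed for kernels built with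
`withDensity`. Test functions of `X` alone show that `η (X ω)` has mass one almost surely; elsewhere
`η` is replaced by zero. -/
theorem condDistrib_ae_eq_of_lintegral (hX : Measurable X) (hY : Measurable Y)
    (η : Kernel 𝓧 E) (h : ∀ φ : 𝓧 × E → ENNReal, Measurable φ →
      ∫⁻ ω, φ (X ω, Y ω) ∂μ = ∫⁻ ω, ∫⁻ y, φ (X ω, y) ∂(η (X ω)) ∂μ) :
    ∀ᵐ ω ∂μ, condDistrib Y X μ (X ω) = η (X ω) := by
  have hηu : Measurable fun x => η x univ := Kernel.measurable_coe _ MeasurableSet.univ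
  let S : Set 𝓧 := {x | η x univ = 1}
  have hS : MeasurableSet S := hηu (measurableSet_singleton 1)
  have hSX : ∀ᵐ ω ∂μ, X ω ∈ S := by
    refine ae_of_ae_map (p := (· ∈ S)) hX.aemeasurable ?_
    have : (fun x => η x univ) =ᵐ[μ.map X] fun _ => 1 := by
      refine ae_eq_of_forall_setLIntegral_eq_of_sigmaFinite hηu measurable_const fun t ht _ => ?_
      rw [← lintegral_indicator ht, ← lintegral_indicator ht,
        lintegral_map (hηu.indicator ht) hX, lintegral_map (measurable_const.indicator ht) hX]
      have hφ : Measurable fun q : 𝓧 × E => t.indicator (fun _ => (1 : ENNReal)) q.1 :=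
        (measurable_const.indicator ht).comp measurable_fst
      have := h _ hφ
      simp only [lintegral_const] at this
      rw [this]
      refine lintegral_congr fun ω => ?_
      by_cases hω : X ω ∈ t <;> simp [hω]
    exact this
  classical
  let η' : Kernel 𝓧 E := Kernel.piecewise hS η 0
  have : IsFiniteKernel η' := ⟨1, ENNReal.one_lt_top, fun x => by
    by_cases hx : x ∈ S
    · simpa [η', Kernel.piecewise_apply, hx] using (show η x univ = 1 from hx).le
    · simp [η', Kernel.piecewise_apply, hx]⟩
  have key : condDistrib Y X μ =ᵐ[μ.map X] η' := by
    refine condDistrib_ae_eq_of_measure_eq_compProd _ hY.aemeasurable ?_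
    refine Measure.ext_of_lintegral _ fun φ hφ => ?_
    rw [Measure.lintegral_compProd hφ, lintegral_map hφ (hX.prodMk hY),
      lintegral_map hφ.lintegral_kernel_prod_right' hX, h φ hφ]
    refine lintegral_congr_ae ?_
    filter_upwards [hSX] with ω hω
    simp [η', Kernel.piecewise_apply, hω]
  filter_upwards [ae_of_ae_map hX.aemeasurable key, hSX] with ω h1 h2
  rw [h1]
  simp [η', Kernel.piecewise_apply, h2]

/-- If the conditional law of `(Y, Z)` given `X` has a density with respect to the product of the
conditional laws of `Y` and `Z`, then this density describes the conditional law of `Y` given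
`(X, Z)`. -/
theorem condDistrib_prodMk_right_ae_eq_withDensity (hX : Measurable X) (hY : Measurable Y)
    {Z : Ω → E'} (hZ : Measurable Z) {f : 𝓧 → E → E' → ENNReal}
    (hf : Measurable fun q : 𝓧 × E × E' => f q.1 q.2.1 q.2.2)
    (h : ∀ᵐ ω ∂μ, condDistrib (fun ω => (Y ω, Z ω)) X μ (X ω) =
      ((condDistrib Y X μ (X ω)).prod (condDistrib Z X μ (X ω))).withDensity
        fun q => f (X ω) q.1 q.2) :
    ∀ᵐ ω ∂μ, condDistrib Y (fun ω => (X ω, Z ω)) μ (X ω, Z ω) =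
      (condDistrib Y X μ (X ω)).withDensity fun y => f (X ω) y (Z ω) := by
  have hf' : Measurable (Function.uncurry fun (q : 𝓧 × E') (y : E) => f q.1 y q.2) :=
    hf.comp (by fun_prop : Measurable fun q : (𝓧 × E') × E => (q.1.1, q.2, q.1.2))
  let κ : Kernel (𝓧 × E') E := (condDistrib Y X μ).comap Prod.fst measurable_fst
  have := condDistrib_ae_eq_of_lintegral (μ := μ) (hX.prodMk hZ) hY
    (κ.withDensity fun q y => f q.1 y q.2) fun φ hφ => ?_
  · filter_upwards [this] with ω hω
    rw [hω, Kernel.withDensity_apply _ hf']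
    rfl
  have hψ : Measurable fun q : (𝓧 × E') × E => f q.1.1 q.2 q.1.2 * φ q := hf'.mul hφ
  have h1 : ∀ q : 𝓧 × E', ∫⁻ y, φ (q, y) ∂(κ.withDensity (fun q y => f q.1 y q.2) q) =
      ∫⁻ y, f q.1 y q.2 * φ (q, y) ∂(condDistrib Y X μ q.1) := fun q => by
    rw [Kernel.withDensity_apply _ hf']
    exact lintegral_withDensity_eq_lintegral_mul _ (hf'.comp measurable_prodMk_left)
      (hφ.comp measurable_prodMk_left)
  have h2 : Measurable fun q : 𝓧 × E' =>
      ∫⁻ y, f q.1 y q.2 * φ (q, y) ∂(condDistrib Y X μ q.1) :=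
    hψ.lintegral_kernel_prod_right' (κ := κ)
  simp_rw [h1]
  rw [lintegral_condDistrib hX hZ h2]
  have h3 : Measurable fun q : 𝓧 × E × E' => φ ((q.1, q.2.2), q.2.1) := hφ.comp (by fun_prop)
  -- Given `X`, both sides are the integral of `f * φ` against the product of the conditional laws
  -- of `Y` and `Z`, so Tonelli concludes.
  refine (lintegral_condDistrib hX (hY.prodMk hZ) h3).trans (lintegral_congr_ae ?_)
  filter_upwards [h] with ω hω
  have m1 : Measurable fun q : E × E' => f (X ω) q.1 q.2 := hf.comp measurable_prodMk_left
  have m2 : Measurable fun q : E × E' => φ ((X ω, q.2), q.1) := h3.comp measurable_prodMk_left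
  rw [hω]
  exact (lintegral_withDensity_eq_lintegral_mul _ m1 m2).trans
    (lintegral_prod_symm _ (m1.mul m2).aemeasurable)

end CondDistrib

/-! ### Measurability and locality of conditional distribution functions -/

theorem condCDF_eq_cdf {ι : Type} (μ : Measure (ι → ℝ)) [IsFiniteMeasure μ] (l : ι) (D : Finset ι)
    (z : ι → ℝ) (a : ℝ) :
    condCDF μ l D z a = ProbabilityTheory.cdf
      (condDistrib (fun w : ι → ℝ => w l) (fun w => D.restrict w) μ (D.restrict z)) a :=
  (cdf_eq_real _ _).symm

theorem measurable_cdf_kernel {𝓧 : Type*} [MeasurableSpace 𝓧] (κ : Kernel 𝓧 ℝ)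
    [IsMarkovKernel κ] : Measurable fun q : 𝓧 × ℝ => ProbabilityTheory.cdf (κ q.1) q.2 := by
  have h1 : MeasurableSet {r : (𝓧 × ℝ) × ℝ | r.2 ≤ r.1.2} :=
    measurableSet_le (by fun_prop) (by fun_prop)
  have h2 : Measurable fun q : 𝓧 × ℝ => (κ.comap Prod.fst (measurable_fst (β := ℝ))) q
      (Prod.mk q ⁻¹' {r : (𝓧 × ℝ) × ℝ | r.2 ≤ r.1.2}) := Kernel.measurable_kernel_prodMk_left h1
  simp_rw [cdf_eq_real]
  exact h2.ennreal_toReal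

theorem measurable_condCDF {ι : Type} (μ : Measure (ι → ℝ)) [IsFiniteMeasure μ] (l : ι)
    (D : Finset ι) : Measurable fun q : (ι → ℝ) × ℝ => condCDF μ l D q.1 q.2 := by
  simp_rw [condCDF_eq_cdf]
  have h : Measurable fun q : (ι → ℝ) × ℝ => (D.restrict q.1, q.2) :=
    ((Finset.measurable_restrict D).comp measurable_fst).prodMk measurable_snd
  exact (measurable_cdf_kernel
    (condDistrib (fun w : ι → ℝ => w l) (fun w => D.restrict w) μ)).comp h

theorem condCDF_congr {ι : Type} (μ : Measure (ι → ℝ)) [IsFiniteMeasure μ] (l : ι) {D : Finset ι}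
    {z z' : ι → ℝ} (h : ∀ i ∈ D, z i = z' i) (a : ℝ) : condCDF μ l D z a = condCDF μ l D z' a := by
  have : D.restrict z = D.restrict z' := funext fun i => h i i.2
  rw [condCDF, condCDF, this]

/-! ### From the copula scale to the original scale -/

section Laws

variable {ι : Type} [Fintype ι]

theorem quasiMeasurePreserving_restrict_eval (D : Finset ι) {l : ι} (hl : l ∉ D) :
    Measure.QuasiMeasurePreserving (fun z : ι → ℝ => (D.restrict z, z l)) volume
      ((volume : Measure (D → ℝ)).prod volume) := by
  classical
  have h1 := (volume_preserving_piEquivPiSubtypeProd (fun _ : ι => ℝ) (· ∈ D)).quasiMeasurePreserving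
  have h2 : Measure.QuasiMeasurePreserving (fun w : {i // i ∉ D} → ℝ => w ⟨l, hl⟩) volume volume :=
    Measure.quasiMeasurePreserving_eval _ _
  have h3 := (QuasiMeasurePreserving.prodMap (Measure.QuasiMeasurePreserving.id _) h2).comp h1
  convert h3 using 1
  · rfl
  · rfl
  · congr!

/-- Makes the conditional margins atomless, as Sklar's theorem requires. -/
theorem condDistrib_eval_absolutelyContinuous {μ : Measure (ι → ℝ)} [IsFiniteMeasure μ]
    (hμ : μ ≪ volume) (D : Finset ι) {l : ι} (hl : l ∉ D) :
    ∀ᵐ z ∂μ, condDistrib (fun w : ι → ℝ => w l) (fun w => D.restrict w) μ (D.restrict z) ≪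
      volume := by
  have hm : Measurable fun w : ι → ℝ => D.restrict w := Finset.measurable_restrict D
  have h1 : μ.map (fun z : ι → ℝ => (D.restrict z, z l)) ≪
      (volume : Measure (D → ℝ)).prod (volume : Measure ℝ) :=
    (hμ.map (hm.prodMk (measurable_pi_apply l))).trans
      (quasiMeasurePreserving_restrict_eval D hl).absolutelyContinuous
  -- Lebesgue measure is replaced by an equivalent finite measure, so that the constant kernel is
  -- finite.
  have h2 : μ.map (fun z : ι → ℝ => (D.restrict z, z l)) ≪
      (volume : Measure (D → ℝ)) ⊗ₘ Kernel.const _ (volume : Measure ℝ).toFinite := by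
    rw [Measure.compProd_const]
    exact h1.trans (Measure.AbsolutelyContinuous.rfl.prod (absolutelyContinuous_toFinite _))
  rw [← compProd_map_condDistrib (measurable_pi_apply l).aemeasurable] at h2
  filter_upwards [ae_of_ae_map hm.aemeasurable h2.kernel_of_compProd] with z hz
  rw [Kernel.const_apply] at hz
  exact hz.trans (toFinite_absolutelyContinuous _)

theorem nullSingletonClass_of_absolutelyContinuous {α : Measure ℝ} (h : α ≪ volume) :
    NullSingletonClass α :=
  ⟨fun _ => h (measure_singleton _)⟩

theorem marginal_absolutelyContinuous {μ : Measure (ι → ℝ)} (hμ : μ ≪ volume) (l : ι) :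
    marginal μ l ≪ volume :=
  (hμ.map (measurable_pi_apply l)).trans
    (Measure.quasiMeasurePreserving_eval (fun _ : ι => (volume : Measure ℝ)) l).absolutelyContinuous

instance isProbabilityMeasure_marginal (μ : Measure (ι → ℝ)) [IsProbabilityMeasure μ] (l : ι) :
    IsProbabilityMeasure (marginal μ l) :=
  Measure.isProbabilityMeasure_map (measurable_pi_apply l).aemeasurable

/-- The coordinatewise left inverses recover `z_D` from its transform almost surely, so both carry
the same conditioning information; the transform acts on `Y` through `φ`. -/
theorem condDistrib_copula {E : Type*} [MeasurableSpace E] [StandardBorelSpace E] [Nonempty E]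
    {μ : Measure (ι → ℝ)} [IsProbabilityMeasure μ] (hμ : μ ≪ volume) (D : Finset ι)
    {Y : (ι → ℝ) → E} (hY : Measurable Y) {φ : E → E} (hφ : Measurable φ)
    (h : ∀ z : ι → ℝ, Y (fun l => ProbabilityTheory.cdf (marginal μ l) (z l)) = φ (Y z)) :
    ∀ᵐ z ∂μ, condDistrib Y (fun w => D.restrict w) (copula μ)
        (D.restrict fun l => ProbabilityTheory.cdf (marginal μ l) (z l)) =
      (condDistrib Y (fun w => D.restrict w) μ (D.restrict z)).map φ := by
  have hF : ∀ l, Measurable (ProbabilityTheory.cdf (marginal μ l)) := fun l =>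
    (monotone_cdf _).measurable
  have hm : Measurable fun w : ι → ℝ => D.restrict w := Finset.measurable_restrict D
  have hT : Measurable fun (z : ι → ℝ) l => ProbabilityTheory.cdf (marginal μ l) (z l) :=
    measurable_pi_lambda _ fun l => (hF l).comp (measurable_pi_apply l)
  have hna : ∀ l, NullSingletonClass (marginal μ l) := fun l =>
    nullSingletonClass_of_absolutelyContinuous (marginal_absolutelyContinuous hμ l)
  choose g hg hgF using fun l => exists_leftInverse_cdf (marginal μ l)
  have h1 := condDistrib_map (ν := μ) (X := fun w : ι → ℝ => D.restrict w) (Y := Y)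
    hm.aemeasurable hY.aemeasurable hT.aemeasurable
  have h2 := condDistrib_comp_right_ae_eq (μ := μ) (X := fun w : ι → ℝ => D.restrict w)
    (Y := φ ∘ Y) hm (hφ.comp hY)
    (g := fun (v : D → ℝ) (i : D) => ProbabilityTheory.cdf (marginal μ i) (v i))
    (measurable_pi_lambda _ fun i => (hF i).comp (measurable_pi_apply i))
    (h := fun (v : D → ℝ) (i : D) => g i (v i))
    (measurable_pi_lambda _ fun i => (hg i).comp (measurable_pi_apply i)) (by
      have : ∀ᵐ z ∂μ, ∀ l, g l (ProbabilityTheory.cdf (marginal μ l) (z l)) = z l :=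
        ae_all_iff.2 fun l => ae_of_ae_map (measurable_pi_apply l).aemeasurable (hgF l)
      filter_upwards [this] with z hz
      ext i
      exact hz i)
  have h3 := condDistrib_comp (μ := μ) (mβ := inferInstance) (fun w : ι → ℝ => D.restrict w) hY.aemeasurable hφ
  filter_upwards [ae_of_ae_map (hm.comp hT).aemeasurable h1, h2,
    ae_of_ae_map hm.aemeasurable h3] with z e1 e2 e3
  rw [Kernel.map_apply _ hφ] at e3
  rw [← e3, ← e2]
  have h4 : (Y ∘ fun (z : ι → ℝ) l => ProbabilityTheory.cdf (marginal μ l) (z l)) = φ ∘ Y :=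
    funext h
  rw [h4] at e1
  exact e1

theorem preimage_cdf_Iic_ae_eq (α κ : Measure ℝ) (s : ℝ) (hκ : κ (flatSet α) = 0) :
    κ.real (ProbabilityTheory.cdf α ⁻¹' Iic (ProbabilityTheory.cdf α s)) = κ.real (Iic s) := by
  refine measureReal_congr ?_
  have h0 : ∀ᵐ t ∂κ, t ∉ flatSet α := measure_eq_zero_iff_ae_notMem.1 hκ
  filter_upwards [h0] with t ht
  exact propext ⟨fun h => (setOf_cdf_le_subset α s h).resolve_right ht, fun h => monotone_cdf α h⟩

/-- The conditional copula of two coordinates is invariant under the probability integral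
transforms. -/
theorem condCDF₂_eq_of_copula {μ : Measure (ι → ℝ)} [IsProbabilityMeasure μ] (hμ : μ ≪ volume)
    (C : PairCopula) (l m : ι) (D : Finset ι)
    (h : ∀ᵐ w ∂(copula μ), ∀ a b : ℝ, condCDF₂ (copula μ) l m D w a b =
      C.cdf (condCDF (copula μ) l D w a) (condCDF (copula μ) m D w b)) :
    ∀ᵐ z ∂μ, ∀ a b : ℝ, condCDF₂ μ l m D z a b =
      C.cdf (condCDF μ l D z a) (condCDF μ m D z b) := by
  have hF : ∀ l, Measurable (ProbabilityTheory.cdf (marginal μ l)) := fun l =>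
    (monotone_cdf _).measurable
  have hm : Measurable fun w : ι → ℝ => D.restrict w := Finset.measurable_restrict D
  have hT : Measurable fun (z : ι → ℝ) l => ProbabilityTheory.cdf (marginal μ l) (z l) :=
    measurable_pi_lambda _ fun l => (hF l).comp (measurable_pi_apply l)
  have hnull : ∀ l, μ ((fun z => z l) ⁻¹' flatSet (marginal μ l)) = 0 := fun l => by
    have := nullSingletonClass_of_absolutelyContinuous (marginal_absolutelyContinuous hμ l)
    rw [← Measure.map_apply (measurable_pi_apply l) (measurableSet_flatSet _)]
    exact measure_flatSet (marginal μ l)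
  have hlm : Measurable fun w : ι → ℝ => (w l, w m) :=
    (measurable_pi_apply l).prodMk (measurable_pi_apply m)
  filter_upwards [ae_of_ae_map hT.aemeasurable h,
    condDistrib_copula hμ D (measurable_pi_apply l) (hF l) fun _ => rfl,
    condDistrib_copula hμ D (measurable_pi_apply m) (hF m) fun _ => rfl,
    condDistrib_copula hμ D hlm ((hF l).prodMap (hF m)) fun _ => rfl,
    condDistrib_null_of_map_null hm (measurable_pi_apply l) (measurableSet_flatSet _) (hnull l),
    condDistrib_null_of_map_null hm (measurable_pi_apply m) (measurableSet_flatSet _) (hnull m),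
    condDistrib_null_of_map_null hm hlm (measurable_fst (measurableSet_flatSet (marginal μ l)))
      (hnull l),
    condDistrib_null_of_map_null hm hlm (measurable_snd (measurableSet_flatSet (marginal μ m)))
      (hnull m)] with z hz e1 e2 e3 n1 n2 n3 n4
  intro a b
  -- At these levels the sublevel sets of the marginal transforms are the rays up to flat sets,
  -- which are null for almost every conditional law.
  have := hz (ProbabilityTheory.cdf (marginal μ l) a) (ProbabilityTheory.cdf (marginal μ m) b)
  simp only [condCDF, condCDF₂] at this ⊢
  rw [e1, e2, e3, map_measureReal_apply (hF l) measurableSet_Iic,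
    map_measureReal_apply (hF m) measurableSet_Iic,
    map_measureReal_apply ((hF l).prodMap (hF m)) (measurableSet_Iic.prod measurableSet_Iic),
    preimage_cdf_Iic_ae_eq _ _ _ n1, preimage_cdf_Iic_ae_eq _ _ _ n2] at this
  rw [← this]
  refine measureReal_congr ?_
  have h3 := measure_eq_zero_iff_ae_notMem.1 n3
  have h4 := measure_eq_zero_iff_ae_notMem.1 n4
  filter_upwards [h3, h4] with t ht3 ht4
  refine propext ⟨fun h => ⟨monotone_cdf _ h.1, monotone_cdf _ h.2⟩, fun h => ⟨?_, ?_⟩⟩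
  · exact (setOf_cdf_le_subset _ a h.1).resolve_right ht3
  · exact (setOf_cdf_le_subset _ b h.2).resolve_right ht4

theorem condDistrib_pair_eq_withDensity {μ : Measure (ι → ℝ)} [IsProbabilityMeasure μ]
    (hμ : μ ≪ volume) (C : PairCopula) {l m : ι} {D : Finset ι} (hl : l ∉ D) (hm : m ∉ D)
    (h : ∀ᵐ w ∂(copula μ), ∀ a b : ℝ, condCDF₂ (copula μ) l m D w a b =
      C.cdf (condCDF (copula μ) l D w a) (condCDF (copula μ) m D w b)) :
    ∀ᵐ z ∂μ, condDistrib (fun w : ι → ℝ => (w l, w m)) (fun w => D.restrict w) μ (D.restrict z) =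
      ((condDistrib (fun w : ι → ℝ => w l) (fun w => D.restrict w) μ (D.restrict z)).prod
        (condDistrib (fun w : ι → ℝ => w m) (fun w => D.restrict w) μ
          (D.restrict z))).withDensity fun q =>
            ENNReal.ofReal (C.density (condCDF μ l D z q.1) (condCDF μ m D z q.2)) := by
  filter_upwards [condCDF₂_eq_of_copula hμ C l m D h,
    condDistrib_eval_absolutelyContinuous hμ D hl,
    condDistrib_eval_absolutelyContinuous hμ D hm] with z hz h1 h2
  have := nullSingletonClass_of_absolutelyContinuous h1
  have := nullSingletonClass_of_absolutelyContinuous h2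
  simp only [condCDF_eq_cdf] at hz ⊢
  exact C.eq_withDensity hz

end Laws

/-! ### Enlarging the conditioning set by one variable -/

theorem condDistrib_empty {ι : Type} {μ : Measure (ι → ℝ)} [IsProbabilityMeasure μ] {D : Finset ι}
    (hD : D = ∅) (l : ι) :
    ∀ᵐ z ∂μ, condDistrib (fun w : ι → ℝ => w l) (fun w => D.restrict w) μ (D.restrict z) =
      marginal μ l := by
  subst hD
  refine condDistrib_ae_eq_of_lintegral (X := (∅ : Finset ι).restrict)
    (Y := fun w : ι → ℝ => w l) (Finset.measurable_restrict _) (measurable_pi_apply l)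
    (Kernel.const ((∅ : Finset ι) → ℝ) (marginal μ l)) fun φ hφ => ?_
  have hsub : ∀ z : ι → ℝ,
      ((∅ : Finset ι).restrict z : (∅ : Finset ι) → ℝ) = 0 := fun z =>
    Subsingleton.elim _ _
  simp only [hsub, Kernel.const_apply, lintegral_const, measure_univ, mul_one]
  exact (lintegral_map (hφ.comp measurable_prodMk_left) (measurable_pi_apply l)).symm

section Laws

variable {ι : Type} [Fintype ι]

theorem condDistrib_insert_eq_withDensity {μ : Measure (ι → ℝ)} [IsProbabilityMeasure μ]
    (hμ : μ ≪ volume) (C : PairCopula) {l m : ι} {D D' : Finset ι} (hl : l ∉ D) (hm : m ∉ D)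
    (hD' : ∀ i, i ∈ D' ↔ i = m ∨ i ∈ D)
    (h : ∀ᵐ w ∂(copula μ), ∀ a b : ℝ, condCDF₂ (copula μ) l m D w a b =
      C.cdf (condCDF (copula μ) l D w a) (condCDF (copula μ) m D w b)) :
    ∀ᵐ z ∂μ, condDistrib (fun w : ι → ℝ => w l) (fun w => D'.restrict w) μ (D'.restrict z) =
      (condDistrib (fun w : ι → ℝ => w l) (fun w => D.restrict w) μ (D.restrict z)).withDensity
        fun y => ENNReal.ofReal (C.density (condCDF μ l D z y) (condCDF μ m D z (z m))) := by
  classical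
  have hr : ∀ D : Finset ι, Measurable fun w : ι → ℝ => D.restrict w := fun D =>
    Finset.measurable_restrict D
  have hf : Measurable fun q : (D → ℝ) × ℝ × ℝ => ENNReal.ofReal (C.density
      (ProbabilityTheory.cdf (condDistrib (fun w : ι → ℝ => w l) (fun w => D.restrict w) μ q.1)
        q.2.1)
      (ProbabilityTheory.cdf (condDistrib (fun w : ι → ℝ => w m) (fun w => D.restrict w) μ q.1)
        q.2.2)) := by
    have h1 := (measurable_cdf_kernel
      (condDistrib (fun w : ι → ℝ => w l) (fun w => D.restrict w) μ)).comp
        (by fun_prop : Measurable fun q : (D → ℝ) × ℝ × ℝ => (q.1, q.2.1))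
    have h2 := (measurable_cdf_kernel
      (condDistrib (fun w : ι → ℝ => w m) (fun w => D.restrict w) μ)).comp
        (by fun_prop : Measurable fun q : (D → ℝ) × ℝ × ℝ => (q.1, q.2.2))
    exact C.measurable_ofReal_density.comp (h1.prodMk h2)
  have h1 := condDistrib_prodMk_right_ae_eq_withDensity (μ := μ)
    (X := fun w : ι → ℝ => D.restrict w) (hr D) (measurable_pi_apply l) (measurable_pi_apply m)
    (f := fun x y t => ENNReal.ofReal (C.density
      (ProbabilityTheory.cdf (condDistrib (fun w : ι → ℝ => w l) (fun w => D.restrict w) μ x) y)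
      (ProbabilityTheory.cdf (condDistrib (fun w : ι → ℝ => w m) (fun w => D.restrict w) μ x) t)))
    hf (by simpa only [condCDF_eq_cdf] using condDistrib_pair_eq_withDensity hμ C hl hm h)
  have hmD' : m ∈ D' := (hD' m).2 (Or.inl rfl)
  have hDD' : ∀ i : D, (i : ι) ∈ D' := fun i => (hD' i).2 (Or.inr i.2)
  -- Conditioning on `z_{D'}` is conditioning on the pair `(z_D, z_m)`; `h` glues the pair back
  -- together.
  have h2 := condDistrib_comp_right_ae_eq (μ := μ) (hr D') (measurable_pi_apply l)
    (g := fun v => (fun i : D => v ⟨i, hDD' i⟩, v ⟨m, hmD'⟩)) (by fun_prop)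
    (h := fun q (i : D') => if hi : (i : ι) ∈ D then q.1 ⟨i, hi⟩ else q.2)
    (measurable_pi_lambda _ fun i => by
      by_cases hi : (i : ι) ∈ D
      · simp only [hi, dite_true]
        fun_prop
      · simp only [hi, dite_false]
        fun_prop)
    (ae_of_all _ fun z => by
      ext i
      by_cases hi : (i : ι) ∈ D
      · simp [hi]
      · simp [((hD' i).1 i.2).resolve_right hi])
  filter_upwards [h1, h2] with z e1 e2
  rw [← e2]
  simp only [condCDF_eq_cdf]
  exact e1

end Laws

/-! ### The factors attached to the edges of the Y-vine -/

variable {p : ℕ}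

theorem mem_predictors_inr {s : Finset (Fin p)} {i : Fin p} :
    (Sum.inr i : Var p) ∈ predictors s ↔ i ∈ s := by
  simp [predictors]

theorem inl_notMem_predictors {s : Finset (Fin p)} {j : Fin 2} :
    (Sum.inl j : Var p) ∉ predictors s := by
  simp [predictors]

theorem conditioning_response (j : Fin 2) (i : Fin p) :
    (Edge.response j i).conditioning = predictors (Finset.Iio i) := by
  ext v
  rcases v with v | v
  · simp [Edge.conditioning, Edge.node₁, Edge.node₂, predictors]
  · simp only [Edge.conditioning, Edge.node₁, Edge.node₂, Finset.mem_inter, Finset.mem_insert,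
      reduceCtorEq, false_or, mem_predictors_inr, Finset.mem_Iio, Finset.mem_Iic]
    exact ⟨fun h => h.1, fun h => ⟨h, h.le⟩⟩

theorem conditioning_top : (Edge.top : Edge p).conditioning = predictors Finset.univ := by
  ext v
  rcases v with v | v
  · simp [Edge.conditioning, Edge.node₁, Edge.node₂, predictors]
  · simp [Edge.conditioning, Edge.node₁, Edge.node₂, predictors]

/-- The factor of the conditional density that belongs to the edge `response j i`. -/
noncomputable def responseFactor (μ : Measure (Var p → ℝ)) [IsFiniteMeasure μ] (C : Edge p → PairCopula)
    (j : Fin 2) (i : Fin p) (z : Var p → ℝ) (y : ℝ) : ENNReal :=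
  ENNReal.ofReal ((C (Edge.response j i)).density
    (condCDF μ (Sum.inl j) (predictors (Finset.Iio i)) z y)
    (condCDF μ (Sum.inr i) (predictors (Finset.Iio i)) z (z (Sum.inr i))))

/-- The factor of the conditional density that belongs to the edge `top`. -/
noncomputable def topFactor (μ : Measure (Var p → ℝ)) [IsFiniteMeasure μ] (C : Edge p → PairCopula)
    (z : Var p → ℝ) (y : ℝ × ℝ) : ENNReal :=
  ENNReal.ofReal ((C Edge.top).density
    (condCDF μ (Sum.inl 0) (predictors Finset.univ) z y.1)
    (condCDF μ (Sum.inl 1) (predictors Finset.univ) z y.2))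

section Factors

variable (μ : Measure (Var p → ℝ)) [IsFiniteMeasure μ] (C : Edge p → PairCopula)

theorem measurable_responseFactor (j : Fin 2) (i : Fin p) :
    Measurable fun q : (Var p → ℝ) × ℝ => responseFactor μ C j i q.1 q.2 := by
  have h2 := (measurable_condCDF μ (Sum.inr i) (predictors (Finset.Iio i))).comp
    (by fun_prop : Measurable fun q : (Var p → ℝ) × ℝ => (q.1, q.1 (Sum.inr i)))
  exact (C _).measurable_ofReal_density.comp ((measurable_condCDF μ _ _).prodMk h2)

theorem measurable_responseFactor_apply (j : Fin 2) (i : Fin p) (z : Var p → ℝ) :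
    Measurable (responseFactor μ C j i z) := by
  have h := (measurable_responseFactor μ C j i).comp (measurable_prodMk_left (x := z))
  exact h

theorem measurable_topFactor :
    Measurable fun q : (Var p → ℝ) × ℝ × ℝ => topFactor μ C q.1 q.2 := by
  have h1 := (measurable_condCDF μ (Sum.inl 0) (predictors Finset.univ)).comp
    (by fun_prop : Measurable fun q : (Var p → ℝ) × ℝ × ℝ => (q.1, q.2.1))
  have h2 := (measurable_condCDF μ (Sum.inl 1) (predictors Finset.univ)).comp
    (by fun_prop : Measurable fun q : (Var p → ℝ) × ℝ × ℝ => (q.1, q.2.2))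
  exact (C _).measurable_ofReal_density.comp (h1.prodMk h2)

theorem measurable_topFactor_apply (z : Var p → ℝ) : Measurable (topFactor μ C z) := by
  have h := (measurable_topFactor μ C).comp (measurable_prodMk_left (x := z))
  exact h

/-- Lets the responses stored in `z` be replaced by the integration variables. -/
theorem responseFactor_congr (j : Fin 2) (i : Fin p) {z z' : Var p → ℝ}
    (h : ∀ i, z (Sum.inr i) = z' (Sum.inr i)) (y : ℝ) :
    responseFactor μ C j i z y = responseFactor μ C j i z' y := by
  have h' : ∀ v ∈ predictors (Finset.Iio i), z v = z' v := by
    rintro (v | v) hv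
    · exact absurd hv inl_notMem_predictors
    · exact h v
  rw [responseFactor, responseFactor, condCDF_congr μ _ h', condCDF_congr μ _ h', h]

theorem topFactor_congr {z z' : Var p → ℝ} (h : ∀ i, z (Sum.inr i) = z' (Sum.inr i)) (y : ℝ × ℝ) :
    topFactor μ C z y = topFactor μ C z' y := by
  have h' : ∀ v ∈ predictors (p := p) Finset.univ, z v = z' v := by
    rintro (v | v) hv
    · exact absurd hv inl_notMem_predictors
    · exact h v
  rw [topFactor, topFactor, condCDF_congr μ _ h', condCDF_congr μ _ h']

end Factors

/-! ### Factorization of the joint and the conditional density -/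

theorem measurePreserving_sumElim (p : ℕ) :
    MeasurePreserving (fun q : (Fin p → ℝ) × (Fin 2 → ℝ) => (Sum.elim q.2 q.1 : Var p → ℝ))
      (volume.prod volume) volume := by
  have h := (volume_measurePreserving_sumPiEquivProdPi_symm
    (fun _ : Var p => ℝ)).comp Measure.measurePreserving_swap
  convert h using 1
  ext q v
  rcases v with v | v <;> rfl

theorem predictorLaw_absolutelyContinuous {μ : Measure (Var p → ℝ)} (hμ : μ ≪ volume) : predictorLaw μ ≪ volume := by
  have h := (volume_measurePreserving_sumPiEquivProdPi (fun _ : Var p => ℝ)).quasiMeasurePreserving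
  exact (hμ.map (by fun_prop)).trans
    (Measure.quasiMeasurePreserving_snd.comp h).absolutelyContinuous

section YVineLaw

variable {μ : Measure (Var p → ℝ)} [IsProbabilityMeasure μ] {C : Edge p → PairCopula}

theorem condDistrib_response_step (hμ : μ ≪ volume) (hC : IsYVineCopula (copula μ) C)
    (j : Fin 2) (i : Fin p) {s : Finset (Fin p)} (hs : ∀ i', i' ∈ s ↔ i' ≤ i) :
    ∀ᵐ z ∂μ, condDistrib (fun w : Var p → ℝ => w (Sum.inl j)) (fun w => (predictors s).restrict w) μ
        ((predictors s).restrict z) =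
      (condDistrib (fun w : Var p → ℝ => w (Sum.inl j))
        (fun w => (predictors (Finset.Iio i)).restrict w) μ
          ((predictors (Finset.Iio i)).restrict z)).withDensity (responseFactor μ C j i z) := by
  have h := hC.pair (Edge.response j i)
  rw [conditioning_response] at h
  refine condDistrib_insert_eq_withDensity hμ _ inl_notMem_predictors ?_ ?_ h
  · simp [mem_predictors_inr]
  · rintro (v | v)
    · simp [inl_notMem_predictors]
    · simp only [mem_predictors_inr, hs, Finset.mem_Iio, Sum.inr.injEq]
      exact le_iff_eq_or_lt

theorem condDistrib_response_eq_withDensity (hμ : μ ≪ volume) (hC : IsYVineCopula (copula μ) C)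
    (j : Fin 2) :
    ∀ᵐ z ∂μ, condDistrib (fun w : Var p → ℝ => w (Sum.inl j))
        (fun w => (predictors Finset.univ).restrict w) μ ((predictors Finset.univ).restrict z) =
      (marginal μ (Sum.inl j)).withDensity fun y => ∏ i, responseFactor μ C j i z y := by
  -- Induction on the number `k` of predictors conditioned on. Describing `s` by membership covers
  -- `∅`, every `Iio i` and also `univ`, which is no `Iio i` in `Fin p`.
  suffices h : ∀ k ≤ p, ∀ s : Finset (Fin p), (∀ i, i ∈ s ↔ i.val < k) →
      ∀ᵐ z ∂μ, condDistrib (fun w : Var p → ℝ => w (Sum.inl j))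
        (fun w => (predictors s).restrict w) μ ((predictors s).restrict z) =
      (marginal μ (Sum.inl j)).withDensity fun y => ∏ i ∈ s, responseFactor μ C j i z y from
    h p le_rfl Finset.univ fun i => by simp
  intro k
  induction k with
  | zero =>
    intro _ s hs
    have hs0 : s = ∅ := Finset.eq_empty_of_forall_notMem fun i hi => by simpa using (hs i).1 hi
    subst hs0
    filter_upwards [condDistrib_empty (μ := μ) (D := predictors (p := p) ∅) rfl (Sum.inl j)]
      with z hz
    rw [hz]
    simp
  | succ k ih =>
    intro hk s hs
    let i : Fin p := ⟨k, hk⟩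
    have hsi : s = insert i (Finset.Iio i) := by
      ext i'
      simp only [hs, Finset.mem_insert, Finset.mem_Iio, Fin.ext_iff, Fin.lt_def, i]
      omega
    filter_upwards [ih (by omega) (Finset.Iio i) fun i' => by simp [Fin.lt_def, i],
      condDistrib_response_step hμ hC j i (s := s) fun i' => by
        simp only [hs, Fin.le_def, i]; omega] with z h1 h2
    have hm : ∀ i, Measurable (responseFactor μ C j i z) := fun i =>
      measurable_responseFactor_apply μ C j i z
    rw [h2, h1, ← withDensity_mul _ (Finset.measurable_fun_prod _ fun i _ => hm i) (hm i), hsi]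
    refine congrArg _ (funext fun y => ?_)
    rw [Finset.prod_insert (by simp), mul_comm, Pi.mul_apply]

/-- The right-hand side of the factorization of the conditional density. -/
noncomputable def yvineDensity (μ : Measure (Var p → ℝ)) [IsFiniteMeasure μ] (C : Edge p → PairCopula)
    (z : Var p → ℝ) : ENNReal :=
  (∏ i : Fin p, ∏ j : Fin 2, responseFactor μ C j i z (z (Sum.inl j))) *
    topFactor μ C z (z (Sum.inl 0), z (Sum.inl 1)) *
    ∏ j : Fin 2, (marginal μ (Sum.inl j)).rnDeriv volume (z (Sum.inl j))

theorem measurable_yvineDensity (μ : Measure (Var p → ℝ)) [IsFiniteMeasure μ]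
    (C : Edge p → PairCopula) : Measurable (yvineDensity μ C) := by
  have h1 : ∀ i j, Measurable fun z : Var p → ℝ => responseFactor μ C j i z (z (Sum.inl j)) := by
    intro i j
    have h : Measurable fun z : Var p → ℝ => (z, z (Sum.inl j)) := by fun_prop
    have h' := (measurable_responseFactor μ C j i).comp h
    exact h'
  have h2 : Measurable fun z : Var p → ℝ => topFactor μ C z (z (Sum.inl 0), z (Sum.inl 1)) := by
    have h : Measurable fun z : Var p → ℝ => (z, z (Sum.inl 0), z (Sum.inl 1)) := by fun_prop
    have h' := (measurable_topFactor μ C).comp h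
    exact h'
  have h3 : ∀ j, Measurable fun z : Var p → ℝ =>
      (marginal μ (Sum.inl j)).rnDeriv volume (z (Sum.inl j)) := fun j =>
    (Measure.measurable_rnDeriv _ _).comp (measurable_pi_apply _)
  exact ((Finset.measurable_fun_prod _ fun i _ => Finset.measurable_fun_prod _ fun j _ =>
    h1 i j).mul h2).mul (Finset.measurable_fun_prod _ fun j _ => h3 j)

/-- The top edge gives a density with respect to the product of the laws of `Y_1` and `Y_2` given
`X`, and each of these has Lebesgue density `f_{Y_j}` times its response factors. -/
theorem condDistrib_responses_eq_withDensity (hμ : μ ≪ volume) (hC : IsYVineCopula (copula μ) C) :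
    ∀ᵐ z ∂μ, condDistrib (fun w : Var p → ℝ => (w (Sum.inl 0), w (Sum.inl 1)))
        (fun w => (predictors Finset.univ).restrict w) μ ((predictors Finset.univ).restrict z) =
      (volume.prod volume).withDensity fun q =>
        yvineDensity μ C (Sum.elim ![q.1, q.2] fun i => z (Sum.inr i)) := by
  have h := hC.pair Edge.top
  rw [conditioning_top] at h
  filter_upwards [condDistrib_pair_eq_withDensity hμ (C Edge.top) inl_notMem_predictors
      inl_notMem_predictors h, condDistrib_response_eq_withDensity hμ hC 0,
    condDistrib_response_eq_withDensity hμ hC 1] with z h1 h2 h3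
  have hm : ∀ j i, Measurable (responseFactor μ C j i z) := fun j i =>
    measurable_responseFactor_apply μ C j i z
  have hd : ∀ j, Measurable ((marginal μ (Sum.inl j)).rnDeriv volume) := fun j =>
    Measure.measurable_rnDeriv _ _
  have hw : ∀ j, (marginal μ (Sum.inl j)).withDensity (fun y => ∏ i, responseFactor μ C j i z y) =
      volume.withDensity (fun y => (marginal μ (Sum.inl j)).rnDeriv volume y *
        ∏ i, responseFactor μ C j i z y) := fun j => by
    conv_lhs => rw [← Measure.withDensity_rnDeriv_eq _ _ (marginal_absolutelyContinuous hμ _)]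
    exact (withDensity_mul _ (hd j) (Finset.measurable_fun_prod _ fun i _ => hm j i)).symm
  have ht : Measurable (topFactor μ C z) := measurable_topFactor_apply μ C z
  have hp : ∀ j, Measurable fun y => (marginal μ (Sum.inl j)).rnDeriv volume y *
        ∏ i, responseFactor μ C j i z y := fun j =>
    (hd j).mul (Finset.measurable_fun_prod _ fun i _ => hm j i)
  refine h1.trans ?_
  change Measure.withDensity (Measure.prod
    (condDistrib (fun w : Var p → ℝ => w (Sum.inl 0)) _ μ _)
    (condDistrib (fun w : Var p → ℝ => w (Sum.inl 1)) _ μ _)) (topFactor μ C z) = _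
  have hp0 := hp 0
  have hp1 := hp 1
  rw [h2, h3, hw, hw, prod_withDensity hp0 hp1]
  refine (withDensity_mul _
    ((hp0.comp measurable_fst).mul (hp1.comp measurable_snd)) ht).symm.trans
    (congrArg _ (funext fun q => ?_))
  have hr : ∀ j i y, responseFactor μ C j i (Sum.elim ![q.1, q.2] fun i => z (Sum.inr i)) y =
      responseFactor μ C j i z y := fun j i y => responseFactor_congr μ C j i (fun i => Sum.elim_inr _ _ i) y
  have ht' : ∀ y, topFactor μ C (Sum.elim ![q.1, q.2] fun i => z (Sum.inr i)) y =
      topFactor μ C z y := fun y => topFactor_congr μ C (fun i => Sum.elim_inr _ _ i) y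
  simp only [yvineDensity, hr, ht', Fin.prod_univ_two, Finset.prod_mul_distrib, Sum.elim_inl,
    Matrix.cons_val_zero, Matrix.cons_val_one, Pi.mul_apply, Function.comp_apply]
  ring

theorem eq_withDensity_yvineDensity (hμ : μ ≪ volume) (hC : IsYVineCopula (copula μ) C) :
    μ = volume.withDensity fun z =>
      (predictorLaw μ).rnDeriv volume (fun i => z (Sum.inr i)) * yvineDensity μ C z := by
  have hR := measurable_yvineDensity μ C
  have hfX : Measurable ((predictorLaw μ).rnDeriv volume) := Measure.measurable_rnDeriv _ _
  have hx : Measurable fun (z : Var p → ℝ) i => z (Sum.inr i) := by fun_prop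
  have : IsProbabilityMeasure (predictorLaw μ) := Measure.isProbabilityMeasure_map hx.aemeasurable
  have hfXz : Measurable fun z : Var p → ℝ => (predictorLaw μ).rnDeriv volume
      fun i => z (Sum.inr i) := hfX.comp hx
  refine Measure.ext_of_lintegral _ fun φ hφ => ?_
  -- Rebuilds `z` from its predictors and its two responses, so that `φ z` becomes a function of the
  -- conditioning variable and the conditioned pair.
  let assemble : (predictors (p := p) Finset.univ → ℝ) × (ℝ × ℝ) → Var p → ℝ := fun q =>
    Sum.elim ![q.2.1, q.2.2] fun i => q.1 ⟨Sum.inr i, mem_predictors_inr.2 (Finset.mem_univ i)⟩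
  have hassemble : Measurable assemble := by
    refine measurable_pi_lambda _ ?_
    rintro (v | v)
    · fin_cases v
      · exact measurable_fst.comp measurable_snd
      · exact measurable_snd.comp measurable_snd
    · exact (measurable_pi_apply _).comp measurable_fst
  have hself : ∀ z : Var p → ℝ, assemble ((predictors Finset.univ).restrict z,
      (z (Sum.inl 0), z (Sum.inl 1))) = z := fun z => by
    ext v
    rcases v with v | v
    · fin_cases v <;> rfl
    · rfl
  have helim : Measurable fun q : (Fin p → ℝ) × (Fin 2 → ℝ) => (Sum.elim q.2 q.1 : Var p → ℝ) :=
    (measurePreserving_sumElim p).measurable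
  have hφR : Measurable fun q : (Fin p → ℝ) × (Fin 2 → ℝ) =>
      yvineDensity μ C (Sum.elim q.2 q.1) * φ (Sum.elim q.2 q.1) :=
    (hR.comp helim).mul (hφ.comp helim)
  have hinner : Measurable fun x : Fin p → ℝ => ∫⁻ y : Fin 2 → ℝ,
      yvineDensity μ C (Sum.elim y x) * φ (Sum.elim y x) := hφR.lintegral_prod_right'
  calc ∫⁻ z, φ z ∂μ
      = ∫⁻ z, (φ ∘ assemble) ((predictors Finset.univ).restrict z,
          (z (Sum.inl 0), z (Sum.inl 1))) ∂μ := by simp only [Function.comp_apply, hself]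
    _ = ∫⁻ z, ∫⁻ q, (φ ∘ assemble) ((predictors Finset.univ).restrict z, q)
          ∂(condDistrib (fun w : Var p → ℝ => (w (Sum.inl 0), w (Sum.inl 1)))
            (fun w => (predictors Finset.univ).restrict w) μ
              ((predictors Finset.univ).restrict z)) ∂μ :=
        lintegral_condDistrib (Finset.measurable_restrict _) (by fun_prop) (hφ.comp hassemble)
    _ = ∫⁻ z, (∫⁻ y : Fin 2 → ℝ, yvineDensity μ C (Sum.elim y fun i => z (Sum.inr i)) *
          φ (Sum.elim y fun i => z (Sum.inr i))) ∂μ := by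
        refine lintegral_congr_ae ?_
        filter_upwards [condDistrib_responses_eq_withDensity hμ hC] with z hz
        have hvec : Measurable fun q : ℝ × ℝ =>
            (Sum.elim ![q.1, q.2] fun i => z (Sum.inr i) : Var p → ℝ) :=
          hassemble.comp (measurable_prodMk_left (x := (predictors Finset.univ).restrict z))
        rw [hz]
        refine (lintegral_withDensity_eq_lintegral_mul _ (hR.comp hvec) (hφ.comp hvec)).trans ?_
        have hpres := volume_preserving_finTwoArrow ℝ
        rw [← Measure.volume_eq_prod, ← hpres.lintegral_comp_emb
          (MeasurableEquiv.finTwoArrow).measurableEmbedding]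
        refine lintegral_congr fun y => ?_
        have hy : ![y 0, y 1] = y := by
          ext j
          fin_cases j <;> rfl
        simp [MeasurableEquiv.finTwoArrow, hy]
    _ = ∫⁻ x, (∫⁻ y : Fin 2 → ℝ, yvineDensity μ C (Sum.elim y x) * φ (Sum.elim y x))
          ∂(predictorLaw μ) := (lintegral_map hinner hx).symm
    _ = ∫⁻ x, (predictorLaw μ).rnDeriv volume x * ∫⁻ y : Fin 2 → ℝ,
          yvineDensity μ C (Sum.elim y x) * φ (Sum.elim y x) := by
        conv_lhs => rw [← Measure.withDensity_rnDeriv_eq _ _ (predictorLaw_absolutelyContinuous hμ)]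
        exact lintegral_withDensity_eq_lintegral_mul _ hfX hinner
    _ = ∫⁻ q : (Fin p → ℝ) × (Fin 2 → ℝ), (predictorLaw μ).rnDeriv volume q.1 *
          (yvineDensity μ C (Sum.elim q.2 q.1) * φ (Sum.elim q.2 q.1)) ∂(volume.prod volume) := by
        refine Eq.trans (lintegral_congr fun x => ?_)
          (lintegral_prod _ ((hfX.comp measurable_fst).mul hφR).aemeasurable).symm
        exact (lintegral_const_mul _ (hφR.comp measurable_prodMk_left)).symm
    _ = ∫⁻ z, φ z ∂(volume.withDensity fun z =>
          (predictorLaw μ).rnDeriv volume (fun i => z (Sum.inr i)) * yvineDensity μ C z) := by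
        refine Eq.trans ?_ (lintegral_withDensity_eq_lintegral_mul _ (hfXz.mul hR) hφ).symm
        refine Eq.trans (lintegral_congr fun q => ?_)
          ((measurePreserving_sumElim p).lintegral_comp ((hfXz.mul hR).mul hφ))
        simp [mul_assoc]

theorem condDensity_ae_eq (hμ : μ ≪ volume) (hC : IsYVineCopula (copula μ) C) :
    ∀ᵐ x ∂(predictorLaw μ), ∀ᵐ y : Fin 2 → ℝ,
      condDensity μ y x = (yvineDensity μ C (Sum.elim y x)).toReal := by
  have hfX : Measurable ((predictorLaw μ).rnDeriv volume) := Measure.measurable_rnDeriv _ _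
  have hx : Measurable fun (z : Var p → ℝ) i => z (Sum.inr i) := by fun_prop
  have : IsProbabilityMeasure (predictorLaw μ) := Measure.isProbabilityMeasure_map hx.aemeasurable
  have hac := predictorLaw_absolutelyContinuous hμ
  have h1 := Measure.rnDeriv_withDensity (volume : Measure (Var p → ℝ))
    ((hfX.comp hx).mul (measurable_yvineDensity μ C))
  have h2 : μ.rnDeriv volume =ᵐ[volume] fun z =>
      (predictorLaw μ).rnDeriv volume (fun i => z (Sum.inr i)) * yvineDensity μ C z := by
    conv_lhs => rw [eq_withDensity_yvineDensity hμ hC]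
    exact h1
  -- Fubini for null sets: the a.e. identity of joint densities holds for almost every `x` and then
  -- almost every `y`.
  have h3 := Measure.ae_ae_of_ae_prod
    ((measurePreserving_sumElim p).quasiMeasurePreserving.ae h2)
  -- `f_X` must be positive and finite to be cancelled; positivity holds almost everywhere for the
  -- law of `X`, not for Lebesgue measure in general.
  filter_upwards [hac.ae_le h3, Measure.rnDeriv_pos hac,
    hac.ae_le (Measure.rnDeriv_lt_top (predictorLaw μ) volume)] with x e1 e2 e3
  filter_upwards [e1] with y e4
  rw [condDensity, density, density, e4, ENNReal.toReal_mul]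
  exact mul_div_cancel_left₀ _ (ENNReal.toReal_pos e2.ne' e3.ne).ne'

theorem toReal_yvineDensity (z : Var p → ℝ) :
    (yvineDensity μ C z).toReal =
      (∏ i : Fin p, ∏ j : Fin 2, (C (Edge.response j i)).density
        (condCDF μ (Sum.inl j) (predictors (Finset.Iio i)) z (z (Sum.inl j)))
        (condCDF μ (Sum.inr i) (predictors (Finset.Iio i)) z (z (Sum.inr i)))) *
      (C Edge.top).density
        (condCDF μ (Sum.inl 0) (predictors Finset.univ) z (z (Sum.inl 0)))
        (condCDF μ (Sum.inl 1) (predictors Finset.univ) z (z (Sum.inl 1))) *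
      ∏ j : Fin 2, marginalDensity μ (Sum.inl j) (z (Sum.inl j)) := by
  simp only [yvineDensity, responseFactor, topFactor, marginalDensity, ENNReal.toReal_mul,
    ENNReal.toReal_prod, ENNReal.toReal_ofReal (PairCopula.density_nonneg _ _ _)]

end YVineLaw

end YVine

/-- `μ` is the joint law of `(Y₁, Y₂, X₁, …, X_p)`; it has a density, and its copula is the Y-vine
copula with pair copulas `C`. -/
theorem theorem2 (p : ℕ) (μ : Measure (YVine.Var p → ℝ)) [IsProbabilityMeasure μ]
    (hμ : μ ≪ volume) (C : YVine.Edge p → YVine.PairCopula)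
    (hC : YVine.IsYVineCopula (YVine.copula μ) C) :
    ∀ᵐ x ∂(YVine.predictorLaw μ), ∀ᵐ y : Fin 2 → ℝ,
      YVine.condDensity μ y x =
        (∏ i : Fin p, ∏ j : Fin 2,
          (C (YVine.Edge.response j i)).density
            (YVine.condCDF μ (Sum.inl j) (YVine.predictors (Finset.Iio i)) (Sum.elim y x) (y j))
            (YVine.condCDF μ (Sum.inr i) (YVine.predictors (Finset.Iio i)) (Sum.elim y x) (x i))) *
        (C YVine.Edge.top).density
          (YVine.condCDF μ (Sum.inl 0) (YVine.predictors Finset.univ) (Sum.elim y x) (y 0))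
          (YVine.condCDF μ (Sum.inl 1) (YVine.predictors Finset.univ) (Sum.elim y x) (y 1)) *
        ∏ j : Fin 2, YVine.marginalDensity μ (Sum.inl j) (y j) := by
  filter_upwards [YVine.condDensity_ae_eq hμ hC] with x hx
  filter_upwards [hx] with y hy
  rw [hy, YVine.toReal_yvineDensity]
  rfl
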